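/- Notation. For a discrete group $\Gamma$ write elements of $L^p(\Gamma)$ as formal sums $\sum_{\gamma\in\Gamma} x_\gamma\gamma$ with complex coefficients and $\sum_\gamma|x_\gamma|^p<\infty$; $L^1(\Gamma)$ is an algebra under convolution, with unit element $e\in\Gamma$, and $L^1(\Gamma)^\times$ is its group of units. Let $\mathcal N\Gamma$ be the von Neumann algebra of bounded operators on $L^2(\Gamma)$ that commute with left multiplication by $\Gamma$, with trace $\tau(A)=(Ae,e)$. The algebra $L^1(\Gamma)$ is viewed as a subalgebra of $\mathcal N\Gamma$ by means of $f\mapsto r(f)=\sum_\gamma f_\gamma R_{\gamma^{-1}}$, where $R_\gamma(x)=x\gamma$. The Fuglede--Kadison determinant is $\det_{\mathcal N\Gamma}A=\exp\tau(\log|A|)$ with $|A|=(A^*A)^{1/2}$ if $A\in\mathcal N\Gamma$ is invertible, and $\det_{\mathcal N\Gamma}A=\lim_{\varepsilon\to0+}\det_{\mathcal N\Gamma}(|A|+\varepsilon)$ in general. For a homomorphism $\varphi:\Gamma\to\Gamma'$ and $f\in L^1(\Gamma)$, the element $\varphi_*(f)\in L^1(\Gamma')$ has the coefficients $\varphi_*(f)_{\gamma'}=\sum_{\gamma\in\varphi^{-1}(\gamma')}f_\gamma$.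 Let $X_d$ be the set of isomorphism classes $[\Gamma,S]$ of groups $\Gamma$ with a family $S=(s_1,\ldots,s_d)$ of $d$ generators (repetitions allowed), isomorphisms being group isomorphisms that respect the families. It is a metric space with the distance $d([\Gamma_1,S_1],[\Gamma_2,S_2])=2^{-N}$, where $N\le\infty$ is the largest radius such that the balls of radius $N$ around the origin in the Cayley graphs of $(\Gamma_1,S_1)$ and $(\Gamma_2,S_2)$ are isomorphic, by an isomorphism fixing the origin, as oriented graphs with edges labelled by $1,\ldots,d$ ($N=0$ if there is no such radius). Corollary. Let $[\Gamma,S]\in X_d$, let $\varphi_n:\Gamma\twoheadrightarrow\Gamma_n$ ($n\in\mathbb N$) be epimorphisms of groups, let $S_n=\varphi_n(S)$ be the induced family of generators of $\Gamma_n$, let $f\in L^1(\Gamma)^\times$, and put $f_n=\varphi_{n*}(f)\in L^1(\Gamma_n)$. If $[\Gamma_n,S_n]\to[\Gamma,S]$ in $X_d$, then $$\det\nolimits_{\mathcal N\Gamma}f=\lim_{n\to\infty}\det\nolimits_{\mathcal N\Gamma_n}f_n .$$ -/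

import Mathlib

open Filter Topology
open scoped ENNReal

universe u

noncomputable section

namespace GroupDet

/-! ### The space of marked groups -/

/-- A group together with a family of `d` generators (repetitions are allowed). -/
structure MarkedGroup (d : ℕ) : Type (u + 1) where
  /-- the underlying group -/
  carrier : Type u
  [group : Group carrier]
  /-- the family of generators -/
  gen : Fin d → carrier
  closure_gen : Subgroup.closure (Set.range gen) = ⊤

attribute [instance] MarkedGroup.group

namespace MarkedGroup

variable {d : ℕ}

/-- Isomorphism of marked groups: a group isomorphism carrying the family of generators of the
first group to that of the second. -/
def Iso (G H : MarkedGroup.{u} d) : Prop :=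
  ∃ α : G.carrier ≃* H.carrier, ∀ i, α (G.gen i) = H.gen i

/-- Evaluation in the group of a word in the generators and their inverses: the letter
`(i, true)` stands for the `i`-th generator, the letter `(i, false)` for its inverse. -/
def eval (G : MarkedGroup.{u} d) (w : List (Fin d × Bool)) : G.carrier :=
  (w.map fun p => if p.2 then G.gen p.1 else (G.gen p.1)⁻¹).prod

/-- The ball of radius `N` around the origin `1` in the Cayley graph (its set of vertices):
the elements that are values of words of length at most `N`. -/
def ball (G : MarkedGroup.{u} d) (N : ℕ) : Set G.carrier :=
  {g | ∃ w : List (Fin d × Bool), w.length ≤ N ∧ G.eval w = g}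

theorem one_mem_ball (G : MarkedGroup.{u} d) (N : ℕ) : (1 : G.carrier) ∈ G.ball N :=
  ⟨[], by simp, by simp [eval]⟩

/-- The Cayley graph has an oriented edge with label `i` from `x` to `y`. -/
def Edge (G : MarkedGroup.{u} d) (i : Fin d) (x y : G.carrier) : Prop :=
  y = x * G.gen i

/-- The balls of radius `N` around the origin in the two Cayley graphs are isomorphic as oriented
labelled graphs, by an isomorphism fixing the centre. -/
def BallIso (N : ℕ) (G H : MarkedGroup.{u} d) : Prop :=
  ∃ e : G.ball N ≃ H.ball N,
    e ⟨1, G.one_mem_ball N⟩ = ⟨1, H.one_mem_ball N⟩ ∧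
    ∀ (i : Fin d) (x y : G.ball N), G.Edge i x y ↔ H.Edge i (e x) (e y)

/-- The largest radius `N ≤ ∞` such that the balls of radius `N` are isomorphic. -/
def radius (G H : MarkedGroup.{u} d) : ℕ∞ :=
  ⨆ (N : ℕ) (_ : BallIso N G H), (N : ℕ∞)

/-- The number `2⁻ᴺ`, for `N ≤ ∞`. -/
def twoPowNeg (N : ℕ∞) : ℝ :=
  if N = ⊤ then 0 else (1 / 2 : ℝ) ^ N.toNat

/-- The distance `2⁻ᴺ`, where `N` is the largest radius for which the balls are isomorphic. -/
def markedDist (G H : MarkedGroup.{u} d) : ℝ :=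
  twoPowNeg (radius G H)

theorem Iso.refl (G : MarkedGroup.{u} d) : Iso G G := ⟨MulEquiv.refl _, fun _ => rfl⟩

theorem Iso.symm {G H : MarkedGroup.{u} d} (h : Iso G H) : Iso H G := by
  obtain ⟨α, hα⟩ := h
  exact ⟨α.symm, fun i => by rw [← hα i, MulEquiv.symm_apply_apply]⟩

theorem Iso.trans {G H K : MarkedGroup.{u} d} (h : Iso G H) (h' : Iso H K) : Iso G K := by
  obtain ⟨α, hα⟩ := h
  obtain ⟨β, hβ⟩ := h'
  exact ⟨α.trans β, fun i => by simp [hα, hβ]⟩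

theorem BallIso.symm {N : ℕ} {G H : MarkedGroup.{u} d} (h : BallIso N G H) : BallIso N H G := by
  obtain ⟨e, he, hE⟩ := h
  refine ⟨e.symm, by rw [← he, Equiv.symm_apply_apply], fun i x y => ?_⟩
  have := hE i (e.symm x) (e.symm y)
  simp only [Equiv.apply_symm_apply] at this
  exact this.symm

theorem BallIso.trans {N : ℕ} {G H K : MarkedGroup.{u} d} (h : BallIso N G H)
    (h' : BallIso N H K) : BallIso N G K := by
  obtain ⟨e, he, hE⟩ := h
  obtain ⟨e', he', hE'⟩ := h'
  exact ⟨e.trans e', by simp [he, he'], fun i x y => (hE i x y).trans (hE' i _ _)⟩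

theorem eval_append (G : MarkedGroup.{u} d) (v w : List (Fin d × Bool)) :
    G.eval (v ++ w) = G.eval v * G.eval w := by
  simp [eval]

theorem eval_singleton (G : MarkedGroup.{u} d) (p : Fin d × Bool) :
    G.eval [p] = if p.2 then G.gen p.1 else (G.gen p.1)⁻¹ := by
  simp [eval]

theorem Iso.eval {G H : MarkedGroup.{u} d} (α : G.carrier ≃* H.carrier)
    (hα : ∀ i, α (G.gen i) = H.gen i) (w : List (Fin d × Bool)) : α (G.eval w) = H.eval w := by
  simp only [MarkedGroup.eval, map_list_prod, List.map_map]
  congr 1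
  apply List.map_congr_left
  rintro ⟨i, b⟩ _
  cases b <;> simp [hα]

theorem Iso.ballIso {G H : MarkedGroup.{u} d} (h : Iso G H) (N : ℕ) : BallIso N G H := by
  obtain ⟨α, hα⟩ := h
  refine ⟨α.toEquiv.subtypeEquiv fun g => ?_, ?_, fun i x y => ?_⟩
  · simp only [ball, Set.mem_ofPred_eq, MulEquiv.toEquiv_eq_coe, EquivLike.coe_coe]
    simp only [← Iso.eval α hα, EmbeddingLike.apply_eq_iff_eq]
  · ext; simp
  · simp only [Edge, Equiv.subtypeEquiv_apply, MulEquiv.toEquiv_eq_coe, EquivLike.coe_coe]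
    rw [← hα i, ← map_mul, EmbeddingLike.apply_eq_iff_eq]

theorem eval_mem_ball (G : MarkedGroup.{u} d) {N : ℕ} {w : List (Fin d × Bool)}
    (hw : w.length ≤ N) : G.eval w ∈ G.ball N := ⟨w, hw, rfl⟩

/-- An isomorphism of balls respects the evaluation of words. -/
theorem ballIso_eval {N : ℕ} {G H : MarkedGroup.{u} d} {e : G.ball N ≃ H.ball N}
    (he : e ⟨1, G.one_mem_ball N⟩ = ⟨1, H.one_mem_ball N⟩)
    (hE : ∀ (i : Fin d) (x y : G.ball N), G.Edge i x y ↔ H.Edge i (e x) (e y))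
    (w : List (Fin d × Bool)) (hw : w.length ≤ N) :
    (e ⟨G.eval w, G.eval_mem_ball hw⟩ : H.carrier) = H.eval w := by
  induction w using List.reverseRecOn with
  | nil => simpa [MarkedGroup.eval] using congrArg Subtype.val he
  | append_singleton w p ih =>
    have hw' : w.length ≤ N := by simp at hw; omega
    have ih := ih hw'
    obtain ⟨i, b⟩ := p
    cases b with
    | true =>
      have := (hE i ⟨G.eval w, G.eval_mem_ball hw'⟩
        ⟨G.eval (w ++ [(i, true)]), G.eval_mem_ball hw⟩).1
        (by simp [Edge, eval_append, eval_singleton])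
      rw [Edge, ih] at this
      rw [this]
      simp [eval_append, eval_singleton]
    | false =>
      have := (hE i ⟨G.eval (w ++ [(i, false)]), G.eval_mem_ball hw⟩
        ⟨G.eval w, G.eval_mem_ball hw'⟩).1
        (by simp [Edge, eval_append, eval_singleton])
      rw [Edge, ih] at this
      have h2 : H.eval (w ++ [(i, false)]) = H.eval w * (H.gen i)⁻¹ := by
        simp [eval_append, eval_singleton]
      rw [h2, this, mul_inv_cancel_right]

theorem BallIso.mono {M N : ℕ} (hMN : M ≤ N) {G H : MarkedGroup.{u} d} (h : BallIso N G H) :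
    BallIso M G H := by
  obtain ⟨e, he, hE⟩ := h
  have hG : G.ball M ⊆ G.ball N := fun g ⟨w, hw, h⟩ => ⟨w, hw.trans hMN, h⟩
  have hH : H.ball M ⊆ H.ball N := fun g ⟨w, hw, h⟩ => ⟨w, hw.trans hMN, h⟩
  have key : ∀ x : G.ball N, (x : G.carrier) ∈ G.ball M ↔ (e x : H.carrier) ∈ H.ball M := by
    intro x
    constructor
    · rintro ⟨w, hw, hx⟩
      refine ⟨w, hw, ?_⟩
      rw [← ballIso_eval he hE w (hw.trans hMN)]
      congr 2
      exact Subtype.ext hx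
    · rintro ⟨w, hw, hx⟩
      refine ⟨w, hw, ?_⟩
      have h1 := ballIso_eval he hE w (hw.trans hMN)
      rw [hx] at h1
      exact congrArg Subtype.val (e.injective (Subtype.ext h1))
  let e' : G.ball M ≃ H.ball M :=
    { toFun := fun x => ⟨e ⟨x, hG x.2⟩, (key ⟨x, hG x.2⟩).1 x.2⟩
      invFun := fun y => ⟨e.symm ⟨y, hH y.2⟩, (key _).2 (by simp)⟩
      left_inv := fun x => by simp
      right_inv := fun y => by simp }
  refine ⟨e', ?_, fun i x y => hE i ⟨x, hG x.2⟩ ⟨y, hG y.2⟩⟩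
  apply Subtype.ext
  change (e ⟨1, G.one_mem_ball N⟩ : H.carrier) = 1
  rw [he]

theorem exists_eval (G : MarkedGroup.{u} d) (g : G.carrier) : ∃ w, G.eval w = g := by
  have hg : g ∈ Subgroup.closure (Set.range G.gen) := by rw [G.closure_gen]; trivial
  induction hg using Subgroup.closure_induction_right with
  | one => exact ⟨[], by simp [MarkedGroup.eval]⟩
  | mul_right x _ y hy ih =>
    obtain ⟨w, rfl⟩ := ih
    obtain ⟨i, rfl⟩ := hy
    exact ⟨w ++ [(i, true)], by simp [eval_append, eval_singleton]⟩
  | mul_inv_cancel x _ y hy ih =>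
    obtain ⟨w, rfl⟩ := ih
    obtain ⟨i, rfl⟩ := hy
    exact ⟨w ++ [(i, false)], by simp [eval_append, eval_singleton]⟩

/-- If all balls are isomorphic, then the marked groups are isomorphic. -/
theorem iso_of_ballIso {G H : MarkedGroup.{u} d} (h : ∀ N, BallIso N G H) : Iso G H := by
  have key : ∀ v w, G.eval v = G.eval w ↔ H.eval v = H.eval w := by
    intro v w
    obtain ⟨e, he, hE⟩ := h (max v.length w.length)
    rw [← ballIso_eval he hE v (le_max_left _ _), ← ballIso_eval he hE w (le_max_right _ _)]
    rw [Subtype.coe_inj, e.injective.eq_iff, Subtype.mk.injEq]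
  choose wd hwd using G.exists_eval
  have hf : ∀ v, H.eval (wd (G.eval v)) = H.eval v := fun v => (key _ _).1 (hwd _)
  let f : G.carrier →* H.carrier :=
    MonoidHom.mk' (fun g => H.eval (wd g)) fun a b => by
      conv_lhs => rw [← hwd a, ← hwd b, ← eval_append, hf, eval_append]
  have hinj : Function.Injective f := by
    intro a b hab
    have := (key (wd a) (wd b)).2 hab
    rwa [hwd, hwd] at this
  have hsurj : Function.Surjective f := by
    intro b
    obtain ⟨w, rfl⟩ := H.exists_eval b
    exact ⟨G.eval w, hf w⟩
  refine ⟨MulEquiv.ofBijective f ⟨hinj, hsurj⟩, fun i => ?_⟩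
  change H.eval (wd (G.gen i)) = H.gen i
  simpa [eval_singleton] using hf [(i, true)]

theorem succ_le_radius_iff {N : ℕ} {G H : MarkedGroup.{u} d} :
    ((N + 1 : ℕ) : ℕ∞) ≤ radius G H ↔ BallIso (N + 1) G H := by
  constructor
  · intro h
    by_contra hn
    have : radius G H ≤ (N : ℕ∞) := by
      refine iSup₂_le fun M hM => ?_
      by_contra hlt
      have hlt : N + 1 ≤ M := by
        have := not_le.1 hlt
        exact_mod_cast this
      exact hn (hM.mono hlt)
    have h2 := h.trans this
    have : N + 1 ≤ N := by exact_mod_cast h2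
    omega
  · intro h
    exact le_iSup₂_of_le (N + 1) h le_rfl

theorem radius_eq_top_iff {G H : MarkedGroup.{u} d} : radius G H = ⊤ ↔ Iso G H := by
  constructor
  · intro h
    refine iso_of_ballIso fun N => ?_
    have : BallIso (N + 1) G H := succ_le_radius_iff.1 (by rw [h]; exact le_top)
    exact this.mono (Nat.le_succ N)
  · intro h
    refine ENat.eq_top_iff_forall_ge.2 fun N => ?_
    exact le_iSup₂_of_le N (h.ballIso N) le_rfl

theorem radius_comm (G H : MarkedGroup.{u} d) : radius G H = radius H G := by
  have : ∀ N, BallIso N G H ↔ BallIso N H G := fun N => ⟨BallIso.symm, BallIso.symm⟩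
  simp only [radius, this]

theorem min_radius_le (G H K : MarkedGroup.{u} d) :
    min (radius G H) (radius H K) ≤ radius G K := by
  refine ENat.forall_natCast_le_iff_le.1 fun N hN => ?_
  obtain ⟨h1, h2⟩ := le_min_iff.1 hN
  cases N with
  | zero => simp
  | succ N => exact succ_le_radius_iff.2 ((succ_le_radius_iff.1 h1).trans (succ_le_radius_iff.1 h2))

theorem twoPowNeg_nonneg (N : ℕ∞) : 0 ≤ twoPowNeg N := by
  unfold twoPowNeg; split_ifs <;> positivity

theorem twoPowNeg_eq_zero_iff {N : ℕ∞} : twoPowNeg N = 0 ↔ N = ⊤ := by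
  unfold twoPowNeg; split_ifs with h <;> simp [h]

theorem twoPowNeg_antitone : Antitone twoPowNeg := by
  intro M N hMN
  by_cases hN : N = ⊤
  · rw [(twoPowNeg_eq_zero_iff (N := N)).2 hN]; exact twoPowNeg_nonneg _
  · have hM : M ≠ ⊤ := fun h => hN (top_le_iff.1 (h ▸ hMN))
    simp only [twoPowNeg, hN, hM, if_false]
    exact pow_le_pow_of_le_one (by norm_num) (by norm_num) (ENat.toNat_le_toNat hMN hN)

theorem markedDist_comm (G H : MarkedGroup.{u} d) : markedDist G H = markedDist H G := by
  rw [markedDist, radius_comm, markedDist]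

theorem markedDist_eq_zero_iff {G H : MarkedGroup.{u} d} : markedDist G H = 0 ↔ Iso G H :=
  twoPowNeg_eq_zero_iff.trans radius_eq_top_iff

theorem markedDist_ultra (G H K : MarkedGroup.{u} d) :
    markedDist G K ≤ max (markedDist G H) (markedDist H K) := by
  have h := twoPowNeg_antitone (min_radius_le G H K)
  rwa [twoPowNeg_antitone.map_min] at h

theorem markedDist_triangle (G H K : MarkedGroup.{u} d) :
    markedDist G K ≤ markedDist G H + markedDist H K :=
  (markedDist_ultra G H K).trans
    (max_le_add_of_nonneg (twoPowNeg_nonneg _) (twoPowNeg_nonneg _))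

theorem markedDist_congr {G G' H H' : MarkedGroup.{u} d} (h : Iso G G') (h' : Iso H H') :
    markedDist G H = markedDist G' H' := by
  have key : ∀ {G G' H H' : MarkedGroup.{u} d}, Iso G G' → Iso H H' →
      markedDist G H ≤ markedDist G' H' := by
    intro G G' H H' h h'
    have h1 := markedDist_triangle G G' H
    have h2 := markedDist_triangle G' H' H
    rw [markedDist_eq_zero_iff.2 h] at h1
    rw [markedDist_eq_zero_iff.2 h'.symm] at h2
    linarith
  exact le_antisymm (key h h') (key h.symm h'.symm)

instance setoid (d : ℕ) : Setoid (MarkedGroup.{u} d) where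
  r := Iso
  iseqv := ⟨Iso.refl, Iso.symm, Iso.trans⟩

end MarkedGroup

/-- The space `X_d` of isomorphism classes of groups marked by `d` generators. -/
def MarkedGroupSpace (d : ℕ) : Type (u + 1) := Quotient (MarkedGroup.setoid.{u} d)

namespace MarkedGroupSpace

variable {d : ℕ}

/-- `X_d` is a metric space with the distance `2⁻ᴺ`. -/
instance : MetricSpace (MarkedGroupSpace.{u} d) where
  dist := Quotient.lift₂ MarkedGroup.markedDist
    fun _ _ _ _ h h' => MarkedGroup.markedDist_congr h h'
  dist_self x := Quotient.inductionOn x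
    fun G => MarkedGroup.markedDist_eq_zero_iff.2 (MarkedGroup.Iso.refl G)
  dist_comm x y := Quotient.inductionOn₂ x y MarkedGroup.markedDist_comm
  dist_triangle x y z := Quotient.inductionOn₃ x y z MarkedGroup.markedDist_triangle
  eq_of_dist_eq_zero {x y} := Quotient.inductionOn₂ x y
    fun _ _ h => Quotient.sound (MarkedGroup.markedDist_eq_zero_iff.1 h)

/-- The class `[Γ, S]` in `X_d` of a group with a family of `d` generators. -/
def mk {Γ : Type u} [Group Γ] (S : Fin d → Γ) (hS : Subgroup.closure (Set.range S) = ⊤) :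
    MarkedGroupSpace.{u} d :=
  Quotient.mk (MarkedGroup.setoid.{u} d) ⟨Γ, S, hS⟩

theorem dist_mk {Γ Γ' : Type u} [Group Γ] [Group Γ'] (S : Fin d → Γ)
    (hS : Subgroup.closure (Set.range S) = ⊤) (S' : Fin d → Γ')
    (hS' : Subgroup.closure (Set.range S') = ⊤) :
    dist (mk S hS) (mk S' hS') = MarkedGroup.markedDist ⟨Γ, S, hS⟩ ⟨Γ', S', hS'⟩ := rfl

end MarkedGroupSpace

/-- The image of a family of generators under an epimorphism is a family of generators. -/
theorem closure_range_comp {d : ℕ} {Γ Γ' : Type u} [Group Γ] [Group Γ'] {S : Fin d → Γ}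
    (hS : Subgroup.closure (Set.range S) = ⊤) {φ : Γ →* Γ'} (hφ : Function.Surjective φ) :
    Subgroup.closure (Set.range (φ ∘ S)) = ⊤ := by
  rw [Set.range_comp, ← MonoidHom.map_closure, hS, ← MonoidHom.range_eq_map,
    MonoidHom.range_eq_top.2 hφ]

/-! ### The convolution algebra `L¹(Γ)` -/

/-- `L¹(Γ)`, the absolutely summable families of complex numbers. -/
abbrev L1 (Γ : Type u) : Type u := lp (fun _ : Γ => ℂ) 1

/-- `L²(Γ)`, with its inner product. -/
abbrev L2 (Γ : Type u) : Type u := lp (fun _ : Γ => ℂ) 2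

/-- The bounded operators on a Hilbert space. -/
abbrev BoundedOp (H : Type u) [NormedAddCommGroup H] [InnerProductSpace ℂ H] : Type u :=
  H →L[ℂ] H

theorem L1.summable_norm {Γ : Type u} (f : L1 Γ) : Summable fun γ => ‖f γ‖ := by
  simpa using (lp.memℓp f).summable (by simp)

theorem memL1_of_summable {Γ : Type u} {f : Γ → ℂ} (hf : Summable fun γ => ‖f γ‖) :
    Memℓp (E := fun _ : Γ => ℂ) f 1 :=
  memℓp_gen (by simpa using hf)

/-- Integration along the fibres: `φ_* f (γ') = ∑ f γ`, over the `γ` with `φ γ = γ'`. -/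
def pushforward {Γ Γ' : Type u} (φ : Γ → Γ') (f : L1 Γ) : L1 Γ' :=
  ⟨fun γ' => ∑' γ : φ ⁻¹' {γ'}, f γ, by
    refine memL1_of_summable ?_
    have h1 : Summable fun p : Σ γ' : Γ', φ ⁻¹' {γ'} => ‖f p.2‖ :=
      (Equiv.sigmaFiberEquiv φ).summable_iff.2 f.summable_norm
    refine Summable.of_nonneg_of_le (fun _ => norm_nonneg _) (fun γ' => ?_) h1.sigma
    exact norm_tsum_le_tsum_norm (h1.sigma_factor γ')⟩

theorem pushforward_apply {Γ Γ' : Type u} (φ : Γ → Γ') (f : L1 Γ) (γ' : Γ') :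
    pushforward φ f γ' = ∑' γ : φ ⁻¹' {γ'}, f γ := rfl

section Unitary

variable {Γ : Type u}

theorem memL2_comp (σ : Equiv.Perm Γ) (x : L2 Γ) :
    Memℓp (E := fun _ : Γ => ℂ) (fun h => x (σ h)) 2 := by
  refine memℓp_gen ?_
  have := (lp.memℓp x).summable (by simp)
  exact σ.summable_iff.2 this

/-- The unitary operator on `L²(Γ)` induced by a permutation `σ` of `Γ`; it sends the basis
vector at `h` to the one at `σ h`. -/
def permOp (σ : Equiv.Perm Γ) : L2 Γ ≃ₗᵢ[ℂ] L2 Γ where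
  toFun x := ⟨fun h => x (σ.symm h), memL2_comp σ.symm x⟩
  invFun x := ⟨fun h => x (σ h), memL2_comp σ x⟩
  map_add' x y := rfl
  map_smul' c x := rfl
  left_inv x := by ext h; simp
  right_inv x := by ext h; simp
  norm_map' x := by
    rw [lp.norm_eq_tsum_rpow (by simp), lp.norm_eq_tsum_rpow (by simp)]
    congr 1
    exact σ.symm.tsum_eq fun h => ‖x h‖ ^ (2 : ℝ≥0∞).toReal

/-- A unitary operator of `L²(Γ)` as a bounded operator. -/
def toOp (U : L2 Γ ≃ₗᵢ[ℂ] L2 Γ) : BoundedOp (L2 Γ) := U.toContinuousLinearEquiv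

theorem toOp_apply (U : L2 Γ ≃ₗᵢ[ℂ] L2 Γ) (x : L2 Γ) : toOp U x = U x := rfl

theorem norm_toOp_le (U : L2 Γ ≃ₗᵢ[ℂ] L2 Γ) : ‖toOp U‖ ≤ 1 :=
  ContinuousLinearMap.opNorm_le_bound _ zero_le_one fun x => by simp [toOp_apply]

end Unitary

section Group

variable {Γ : Type u} [Group Γ]

theorem summable_conv (f g : L1 Γ) :
    Summable fun p : Γ × Γ => ‖f p.2 * g (p.2⁻¹ * p.1)‖ := by
  have h1 : Summable fun p : Γ × Γ => ‖f p.1 * g p.2‖ := by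
    simpa using f.summable_norm.mul_of_nonneg g.summable_norm
      (fun _ => norm_nonneg _) (fun _ => norm_nonneg _)
  let σ : Γ × Γ ≃ Γ × Γ :=
    { toFun := fun p => (p.2, p.2⁻¹ * p.1)
      invFun := fun p => (p.1 * p.2, p.1)
      left_inv := fun p => by simp
      right_inv := fun p => by simp }
  exact σ.summable_iff.2 h1

/-- The product of `L¹(Γ)`: `(f g)(γ) = ∑ f h * g (h⁻¹ γ)`, over all `h`. -/
def conv (f g : L1 Γ) : L1 Γ :=
  ⟨fun γ => ∑' h, f h * g (h⁻¹ * γ), by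
    refine memL1_of_summable ?_
    have h1 := summable_conv f g
    refine Summable.of_nonneg_of_le (fun _ => norm_nonneg _) (fun γ => ?_) h1.prod
    exact norm_tsum_le_tsum_norm (h1.prod_factor γ)⟩

theorem conv_apply (f g : L1 Γ) (γ : Γ) : conv f g γ = ∑' h, f h * g (h⁻¹ * γ) := rfl

open Classical in
/-- The unit element `e` of `L¹(Γ)`. -/
def oneL1 (Γ : Type u) [Group Γ] : L1 Γ := lp.single 1 (1 : Γ) (1 : ℂ)

/-- `f` belongs to the unit group `L¹(Γ)ˣ` of the convolution algebra. -/
def IsL1Unit (f : L1 Γ) : Prop :=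
  ∃ g : L1 Γ, conv f g = oneL1 Γ ∧ conv g f = oneL1 Γ

/-! ### The group von Neumann algebra -/

/-- Left multiplication `x ↦ γ x` on `L²(Γ)`. -/
def leftMul (γ : Γ) : L2 Γ ≃ₗᵢ[ℂ] L2 Γ := permOp (Equiv.mulLeft γ)

/-- Right multiplication `R_γ : x ↦ x γ` on `L²(Γ)`. -/
def rightMul (γ : Γ) : L2 Γ ≃ₗᵢ[ℂ] L2 Γ := permOp (Equiv.mulRight γ)

theorem leftMul_apply (γ : Γ) (x : L2 Γ) (h : Γ) : leftMul γ x h = x (γ⁻¹ * h) := rfl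

theorem rightMul_apply (γ : Γ) (x : L2 Γ) (h : Γ) : rightMul γ x h = x (h * γ⁻¹) := rfl

theorem star_toOp_leftMul (γ : Γ) :
    star (toOp (leftMul γ)) = toOp (leftMul γ⁻¹) := by
  rw [ContinuousLinearMap.star_eq_adjoint]
  refine (LinearIsometryEquiv.adjoint_eq_symm (leftMul γ)).trans ?_
  ext x h
  change x (γ * h) = x (γ⁻¹⁻¹ * h)
  rw [inv_inv]

variable (Γ) in
/-- The von Neumann algebra `𝒩Γ` of bounded operators on `L²(Γ)` that commute with the left
action of `Γ`. -/
def groupVN : VonNeumannAlgebra (L2 Γ) where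
  toStarSubalgebra :=
    StarSubalgebra.centralizer ℂ (Set.range fun γ : Γ => toOp (leftMul γ))
  centralizer_centralizer' := by
    change Set.centralizer (Set.centralizer (Set.centralizer _)) = Set.centralizer _
    exact Set.centralizer_centralizer_centralizer _

/-- The elements of `𝒩Γ` are exactly the left `Γ`-equivariant bounded operators. -/
theorem mem_groupVN_iff {A : BoundedOp (L2 Γ)} :
    A ∈ groupVN Γ ↔ ∀ (γ : Γ) (x : L2 Γ), A (leftMul γ x) = leftMul γ (A x) := by
  have h : A ∈ groupVN Γ ↔
      A ∈ StarSubalgebra.centralizer ℂ (Set.range fun γ : Γ => toOp (leftMul γ)) := Iff.rfl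
  rw [h, StarSubalgebra.mem_centralizer_iff]
  constructor
  · intro h γ x
    exact (congrArg (fun B : BoundedOp (L2 Γ) => B x) (h _ ⟨γ, rfl⟩).1).symm
  · rintro h _ ⟨γ, rfl⟩
    refine ⟨ContinuousLinearMap.ext fun x => (h γ x).symm, ?_⟩
    simp only [star_toOp_leftMul]
    exact ContinuousLinearMap.ext fun x => (h γ⁻¹ x).symm

theorem summable_regRep (f : L1 Γ) :
    Summable fun γ : Γ => f γ • toOp (rightMul γ⁻¹) := by
  refine Summable.of_norm_bounded f.summable_norm fun γ => ?_
  rw [norm_smul]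
  exact mul_le_of_le_one_right (norm_nonneg _) (norm_toOp_le _)

theorem toOp_rightMul_mem (γ : Γ) : toOp (rightMul γ) ∈ groupVN Γ := by
  rw [mem_groupVN_iff]
  intro h x
  ext k
  simp only [toOp_apply, leftMul_apply, rightMul_apply, mul_assoc]

/-- The embedding `r : L¹(Γ) → 𝒩Γ`, `r f = ∑ f_γ R_{γ⁻¹}`; the series converges absolutely in
the operator norm. -/
def regRep (f : L1 Γ) : groupVN Γ :=
  ⟨∑' γ : Γ, f γ • toOp (rightMul γ⁻¹), by
    rw [mem_groupVN_iff]
    intro h x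
    have hs := summable_regRep f
    have hmul : (∑' γ : Γ, f γ • toOp (rightMul γ⁻¹)) * toOp (leftMul h)
        = toOp (leftMul h) * ∑' γ : Γ, f γ • toOp (rightMul γ⁻¹) := by
      rw [← hs.tsum_mul_right, ← hs.tsum_mul_left]
      refine tsum_congr fun γ => ?_
      rw [smul_mul_assoc, mul_smul_comm]
      congr 1
      exact ContinuousLinearMap.ext fun y => mem_groupVN_iff.1 (toOp_rightMul_mem γ⁻¹) h y
    exact congrArg (fun B : BoundedOp (L2 Γ) => B x) hmul⟩

theorem regRep_coe (f : L1 Γ) :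
    (regRep f : BoundedOp (L2 Γ)) = ∑' γ : Γ, f γ • toOp (rightMul γ⁻¹) := rfl

/-! ### The Fuglede–Kadison determinant -/

/-- `|A| = (A* A)^{1/2}`, for a bounded operator `A` on a Hilbert space. -/
def opAbs {H : Type u} [NormedAddCommGroup H] [InnerProductSpace ℂ H] [CompleteSpace H]
    (A : BoundedOp H) : BoundedOp H := CFC.abs A

/-- `log A`, by the continuous functional calculus, for a self-adjoint bounded operator `A` on a
Hilbert space. -/
def opLog {H : Type u} [NormedAddCommGroup H] [InnerProductSpace ℂ H] [CompleteSpace H]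
    (A : BoundedOp H) : BoundedOp H := CFC.log A

open Classical in
/-- The unit element `e` of `Γ` as a vector of `L²(Γ)`. -/
def oneL2 (Γ : Type u) [Group Γ] : L2 Γ := lp.single 2 (1 : Γ) (1 : ℂ)

/-- The canonical trace `τ(A) = (A e, e)`. (The inner product of Mathlib is linear in the second
variable.) -/
def vnTrace (A : BoundedOp (L2 Γ)) : ℂ := inner ℂ (oneL2 Γ) (A (oneL2 Γ))

/-- `exp τ(log |A|)`. As `log |A|` is self-adjoint, its trace is real. -/
def expTraceLog (A : BoundedOp (L2 Γ)) : ℝ :=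
  Real.exp (vnTrace (opLog (opAbs A))).re

open Classical in
/-- The Fuglede–Kadison determinant on `𝒩Γ`: it is `exp τ(log |A|)` for invertible `A`, and the
limit of the determinants of the invertible operators `|A| + ε` for `ε → 0+` in general. -/
def fkDet (A : groupVN Γ) : ℝ :=
  if IsUnit A then expTraceLog (A : BoundedOp (L2 Γ))
  else limUnder (𝓝[>] (0 : ℝ)) fun ε =>
    expTraceLog (opAbs (A : BoundedOp (L2 Γ)) + (ε : ℂ) • (1 : BoundedOp (L2 Γ)))

end Group

end GroupDet

end

/-!
Let `A_n` be the operator on `L²(Γ_n)` given by `φ_{n*} f`, and `A` the one given by `f`. Summing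
over the fibres of `φ_n` shows `A_n = ∑ f_γ R_{φ_n(γ)⁻¹}` (`quotRep`, `regRep_pushforward`), and
`f ↦ A_n` is a unital `*`-homomorphism on `L¹(Γ)` that does not increase norms. If `g` is the
inverse of `f`, then `‖A_n‖ ≤ ‖f‖₁` and `‖A_n⁻¹‖ ≤ ‖g‖₁`, so the spectra of all `A_n* A_n` and
of `A* A` lie in one compact interval of `(0, ∞)` (`spectrum_star_mul_self_subset`). On that
interval `log √t` is a uniform limit of polynomials `p`, and `log |A_n|` is approximated in norm,
uniformly in `n`, by `p(A_n* A_n)` (`norm_opLog_opAbs_sub_aeval_le`).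

For a fixed `p` there is a single `h ∈ L¹(Γ)` whose image on `L²(Γ_n)` is `p(A_n* A_n)`, for
every `n` (`exists_quotRep_eq_aeval`). The trace of that image is the sum of `h` over the kernel
of `φ_n`. Convergence of the marked groups says that every `γ ≠ 1` leaves the kernels eventually
(`eventually_map_ne_one`), so by dominated convergence the traces tend to `h_1 = τ(p(A* A))`
(`tendsto_vnTrace_quotRep`). Hence `τ(log |A_n|) → τ(log |A|)` (`tendsto_vnTrace_opLog`), and the
determinants converge.
-/

namespace GroupDet

/-! ### Separating elements from the kernels -/

theorem MarkedGroup.ballIso_of_dist_lt {d N : ℕ} {G H : MarkedGroup.{u} d}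
    (h : MarkedGroup.markedDist G H < (1 / 2 : ℝ) ^ N) : MarkedGroup.BallIso (N + 1) G H := by
  rw [← MarkedGroup.succ_le_radius_iff]
  by_contra hlt
  have hle : MarkedGroup.radius G H ≤ (N : ℕ∞) := by
    rw [not_le, Nat.cast_add, Nat.cast_one] at hlt
    exact Order.le_of_lt_add_one hlt
  have h2 := MarkedGroup.twoPowNeg_antitone hle
  have h3 : MarkedGroup.twoPowNeg (N : ℕ∞) = (1 / 2 : ℝ) ^ N := by
    simp [MarkedGroup.twoPowNeg]
  rw [h3] at h2
  exact absurd h2 (not_le.2 h)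

/-- Convergence of marked quotients of `Γ` to `Γ` itself means that every nontrivial element
eventually leaves the kernels. -/
theorem eventually_map_ne_one {d : ℕ} {Γ : Type u} [Group Γ] {S : Fin d → Γ}
    (hS : Subgroup.closure (Set.range S) = ⊤)
    {Γ' : ℕ → Type u} [∀ n, Group (Γ' n)] {φ : ∀ n, Γ →* Γ' n}
    (hφ : ∀ n, Function.Surjective (φ n))
    (hconv : Tendsto
      (fun n => MarkedGroupSpace.mk (φ n ∘ S) (closure_range_comp hS (hφ n)))
      atTop (𝓝 (MarkedGroupSpace.mk S hS))) {γ : Γ} (hγ : γ ≠ 1) :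
    ∀ᶠ n in atTop, φ n γ ≠ 1 := by
  obtain ⟨w, hw⟩ := MarkedGroup.exists_eval ⟨Γ, S, hS⟩ γ
  have hpos : (0 : ℝ) < (1 / 2) ^ w.length := by positivity
  filter_upwards [Metric.tendsto_nhds.1 hconv _ hpos] with n hn hn1
  rw [MarkedGroupSpace.dist_mk] at hn
  obtain ⟨e, he, hE⟩ := MarkedGroup.ballIso_of_dist_lt hn
  have hlen : w.length ≤ w.length + 1 := Nat.le_succ _
  have h1 := MarkedGroup.ballIso_eval he hE w hlen
  have h2 : MarkedGroup.eval ⟨Γ' n, φ n ∘ S, closure_range_comp hS (hφ n)⟩ w = φ n γ := by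
    rw [← hw]
    simp only [MarkedGroup.eval, map_list_prod, List.map_map]
    congr 1
    apply List.map_congr_left
    rintro ⟨i, b⟩ _
    cases b <;> simp
  apply hγ
  rw [← hw, ← h1]
  have h3 : (⟨_, MarkedGroup.eval_mem_ball _ hlen⟩ :
      (⟨Γ' n, φ n ∘ S, closure_range_comp hS (hφ n)⟩ : MarkedGroup d).ball (w.length + 1))
      = ⟨1, MarkedGroup.one_mem_ball _ _⟩ := Subtype.ext (h2.trans hn1)
  rw [h3, he]

/-! ### The representation of `L¹(Γ)` on `L²` of a quotient -/

section QuotRep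

theorem norm_smul_toOp_le {X : Type u} (c : ℂ) (U : L2 X ≃ₗᵢ[ℂ] L2 X) : ‖c • toOp U‖ ≤ ‖c‖ := by
  rw [norm_smul]
  exact mul_le_of_le_one_right (norm_nonneg _) (norm_toOp_le _)

variable {Γ Γ' : Type u} [Group Γ] [Group Γ']

theorem toOp_rightMul_mul (a b : Γ) :
    toOp (rightMul a) * toOp (rightMul b) = toOp (rightMul (b * a)) := by
  ext x h
  change x (h * a⁻¹ * b⁻¹) = x (h * (b * a)⁻¹)
  rw [mul_inv_rev, mul_assoc]

theorem toOp_rightMul_one : toOp (rightMul (1 : Γ)) = 1 := by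
  ext x h
  change x (h * 1⁻¹) = x h
  rw [inv_one, mul_one]

theorem star_toOp_rightMul (γ : Γ) : star (toOp (rightMul γ)) = toOp (rightMul γ⁻¹) := by
  rw [ContinuousLinearMap.star_eq_adjoint]
  refine (LinearIsometryEquiv.adjoint_eq_symm (rightMul γ)).trans ?_
  ext x h
  change x (h * γ) = x (h * γ⁻¹⁻¹)
  rw [inv_inv]

/-- The operator `∑ f_γ R_{φ(γ)⁻¹}` on `L²(Γ')`, for a homomorphism `φ : Γ → Γ'` and `f ∈ L¹(Γ)`. -/
noncomputable def quotRep (φ : Γ →* Γ') (f : L1 Γ) : BoundedOp (L2 Γ') :=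
  ∑' γ : Γ, f γ • toOp (rightMul (φ γ)⁻¹)

theorem summable_norm_quotRep (φ : Γ →* Γ') (f : L1 Γ) :
    Summable fun γ : Γ => ‖f γ • toOp (rightMul (φ γ)⁻¹)‖ :=
  Summable.of_nonneg_of_le (fun _ => norm_nonneg _) (fun _ => norm_smul_toOp_le _ _)
    f.summable_norm

theorem norm_quotRep_le (φ : Γ →* Γ') (f : L1 Γ) : ‖quotRep φ f‖ ≤ ∑' γ, ‖f γ‖ :=
  (norm_tsum_le_tsum_norm (summable_norm_quotRep φ f)).trans
    ((summable_norm_quotRep φ f).tsum_le_tsum (fun _ => norm_smul_toOp_le _ _) f.summable_norm)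

/-- The representation of `L¹(Γ)` induced by `φ` is the regular one of `Γ'` after `φ_*`: sum
along the fibres of `φ`. -/
theorem regRep_pushforward (φ : Γ →* Γ') (f : L1 Γ) :
    (regRep (pushforward φ f) : BoundedOp (L2 Γ')) = quotRep φ f := by
  have h1 := (summable_norm_quotRep φ f).of_norm
  have h2 : Summable fun p : Σ γ' : Γ', φ ⁻¹' {γ'} => f p.2 • toOp (rightMul (φ p.2)⁻¹) :=
    (Equiv.sigmaFiberEquiv φ).summable_iff.2 h1
  have h3 : Summable fun p : Σ γ' : Γ', φ ⁻¹' {γ'} => f p.2 :=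
    (Equiv.sigmaFiberEquiv φ).summable_iff.2 f.summable_norm.of_norm
  have h6 : quotRep φ f
      = ∑' p : Σ γ' : Γ', φ ⁻¹' {γ'}, f p.2 • toOp (rightMul (φ p.2)⁻¹) :=
    ((Equiv.sigmaFiberEquiv φ).tsum_eq fun γ => f γ • toOp (rightMul (φ γ)⁻¹)).symm
  rw [h6, h2.tsum_sigma, regRep_coe]
  refine tsum_congr fun γ' => ?_
  have h4 : Summable fun γ : φ ⁻¹' {γ'} => f γ := h3.sigma_factor γ'
  rw [pushforward_apply, ← h4.tsum_smul_const]
  refine tsum_congr fun γ => ?_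
  have h5 : φ (γ : Γ) = γ' := γ.2
  change _ = f γ • toOp (rightMul (φ γ)⁻¹)
  rw [h5]

theorem quotRep_conv (φ : Γ →* Γ') (f g : L1 Γ) :
    quotRep φ (conv f g) = quotRep φ f * quotRep φ g := by
  have hs : Summable fun p : Γ × Γ =>
      (f p.2 * g (p.2⁻¹ * p.1)) • toOp (rightMul (φ p.1)⁻¹) :=
    Summable.of_norm_bounded (summable_conv f g) fun _ => norm_smul_toOp_le _ _
  let σ : Γ × Γ ≃ Γ × Γ :=
    { toFun := fun p => (p.1 * p.2, p.1)
      invFun := fun p => (p.2, p.2⁻¹ * p.1)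
      left_inv := fun p => by simp
      right_inv := fun p => by simp }
  calc quotRep φ (conv f g)
      = ∑' (γ) (h), (f h * g (h⁻¹ * γ)) • toOp (rightMul (φ γ)⁻¹) := by
        refine tsum_congr fun γ => ?_
        rw [conv_apply]
        exact ((summable_conv f g).prod_factor γ).of_norm.tsum_smul_const _ |>.symm
    _ = ∑' p : Γ × Γ, (f p.2 * g (p.2⁻¹ * p.1)) • toOp (rightMul (φ p.1)⁻¹) :=
        hs.tsum_prod.symm
    _ = ∑' p : Γ × Γ, (f p.1 • toOp (rightMul (φ p.1)⁻¹)) *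
          (g p.2 • toOp (rightMul (φ p.2)⁻¹)) := by
        rw [← σ.tsum_eq]
        refine tsum_congr fun p => ?_
        simp only [σ, Equiv.coe_fn_mk, inv_mul_cancel_left]
        rw [smul_mul_smul_comm, toOp_rightMul_mul, map_mul, mul_inv_rev]
    _ = quotRep φ f * quotRep φ g :=
        (tsum_mul_tsum_of_summable_norm (summable_norm_quotRep φ f)
          (summable_norm_quotRep φ g)).symm

theorem quotRep_oneL1 (φ : Γ →* Γ') : quotRep φ (oneL1 Γ) = 1 := by
  classical
  rw [quotRep, tsum_eq_single (1 : Γ)]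
  · simp [oneL1, toOp_rightMul_one]
  · intro γ hγ
    simp [oneL1, hγ]

theorem quotRep_add (φ : Γ →* Γ') (f g : L1 Γ) :
    quotRep φ (f + g) = quotRep φ f + quotRep φ g := by
  rw [quotRep, quotRep, quotRep, ← (summable_norm_quotRep φ f).of_norm.tsum_add
    (summable_norm_quotRep φ g).of_norm]
  exact tsum_congr fun γ => add_smul (f γ) (g γ) _

theorem quotRep_smul (φ : Γ →* Γ') (c : ℂ) (f : L1 Γ) :
    quotRep φ (c • f) = c • quotRep φ f := by
  rw [quotRep, quotRep, ← (summable_norm_quotRep φ f).of_norm.tsum_const_smul]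
  exact tsum_congr fun γ => mul_smul c (f γ) _

/-- The involution `f*(γ) = conj f(γ⁻¹)` of `L¹(Γ)`. -/
noncomputable def starL1 (f : L1 Γ) : L1 Γ :=
  ⟨fun γ => star (f γ⁻¹), memL1_of_summable (by
    simpa [Function.comp_def] using (Equiv.inv Γ).summable_iff.2 f.summable_norm)⟩

theorem quotRep_starL1 (φ : Γ →* Γ') (f : L1 Γ) :
    quotRep φ (starL1 f) = star (quotRep φ f) := by
  rw [quotRep, quotRep, tsum_star, ← (Equiv.inv Γ).tsum_eq]
  refine tsum_congr fun γ => ?_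
  rw [star_smul, star_toOp_rightMul]
  simp [starL1]

/-- A real polynomial in `A* A`, where `A` is the image of `f`, is the image of an element of
`L¹(Γ)` that does not depend on the quotient. -/
theorem exists_quotRep_eq_aeval (f : L1 Γ) (p : Polynomial ℝ) :
    ∃ h : L1 Γ, ∀ {Γ' : Type u} [Group Γ'] (φ : Γ →* Γ'),
      quotRep φ h = Polynomial.aeval (star (quotRep φ f) * quotRep φ f) p := by
  induction p using Polynomial.induction_on with
  | C a =>
    refine ⟨(a : ℂ) • oneL1 Γ, fun φ => ?_⟩
    rw [quotRep_smul, quotRep_oneL1, Polynomial.aeval_C, Algebra.algebraMap_eq_smul_one]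
    exact Complex.coe_smul a _
  | add p q hp hq =>
    obtain ⟨h, hh⟩ := hp
    obtain ⟨k, hk⟩ := hq
    exact ⟨h + k, fun φ => by rw [quotRep_add, hh, hk, map_add]⟩
  | monomial n a ih =>
    obtain ⟨h, hh⟩ := ih
    refine ⟨conv h (conv (starL1 f) f), fun φ => ?_⟩
    rw [quotRep_conv, quotRep_conv, quotRep_starL1, hh, pow_succ, ← mul_assoc (Polynomial.C a),
      map_mul _ _ Polynomial.X, Polynomial.aeval_X]

/-! ### The trace -/

theorem norm_vnTrace_le (A : BoundedOp (L2 Γ)) : ‖vnTrace A‖ ≤ ‖A‖ := by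
  classical
  have h1 : ‖oneL2 Γ‖ = 1 := by
    rw [oneL2, lp.norm_single (by norm_num)]
    simp
  calc ‖vnTrace A‖ ≤ ‖oneL2 Γ‖ * ‖A (oneL2 Γ)‖ := norm_inner_le_norm _ _
    _ ≤ ‖oneL2 Γ‖ * (‖A‖ * ‖oneL2 Γ‖) := by gcongr; exact A.le_opNorm _
    _ = ‖A‖ := by rw [h1, mul_one, one_mul]

theorem vnTrace_sub (A B : BoundedOp (L2 Γ)) : vnTrace (A - B) = vnTrace A - vnTrace B :=
  inner_sub_right _ _ _

open Classical in
theorem vnTrace_toOp_rightMul (γ : Γ) :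
    vnTrace (toOp (rightMul γ)) = if γ = 1 then 1 else 0 := by
  rw [vnTrace]
  conv_lhs => rw [oneL2, lp.inner_single_left]
  rw [toOp_apply, rightMul_apply]
  by_cases h : γ = 1
  · simp [h]
  · simp [h]

open Classical in
/-- The trace of the image of `f` is the sum of the coefficients of `f` over the kernel. -/
theorem vnTrace_quotRep (φ : Γ →* Γ') (f : L1 Γ) :
    vnTrace (quotRep φ f) = ∑' γ, if φ γ = 1 then f γ else 0 := by
  let τ : BoundedOp (L2 Γ') →L[ℂ] ℂ :=
    (innerSL ℂ (oneL2 Γ')).comp (ContinuousLinearMap.apply ℂ (L2 Γ') (oneL2 Γ'))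
  change τ (quotRep φ f) = _
  rw [quotRep, τ.map_tsum (summable_norm_quotRep φ f).of_norm]
  refine tsum_congr fun γ => ?_
  rw [map_smul]
  change f γ • vnTrace (toOp (rightMul (φ γ)⁻¹)) = _
  rw [vnTrace_toOp_rightMul]
  by_cases h : φ γ = 1 <;> simp [h]

/-- If the kernels of the `φ n` shrink to the trivial group pointwise, then the traces of the
images of `f` converge to the trace of `f`, by dominated convergence. -/
theorem tendsto_vnTrace_quotRep {Γ' : ℕ → Type u} [∀ n, Group (Γ' n)] {φ : ∀ n, Γ →* Γ' n}
    (hφ : ∀ γ, γ ≠ 1 → ∀ᶠ n in atTop, φ n γ ≠ 1) (f : L1 Γ) :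
    Tendsto (fun n => vnTrace (quotRep (φ n) f)) atTop
      (𝓝 (vnTrace (quotRep (MonoidHom.id Γ) f))) := by
  classical
  simp only [vnTrace_quotRep]
  refine tendsto_tsum_of_dominated_convergence f.summable_norm (fun γ => ?_)
    (Eventually.of_forall fun n γ => ?_)
  · refine tendsto_const_nhds.congr' ?_
    by_cases h : γ = 1
    · simp [h]
    · filter_upwards [hφ γ h] with n hn
      simp [h, hn]
  · split_ifs <;> simp

end QuotRep

/-! ### Polynomial approximation of the logarithm -/

section Log

variable {H : Type u} [NormedAddCommGroup H] [InnerProductSpace ℂ H] [CompleteSpace H]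

/-- The spectrum of `A* A` is bounded away from `0` and `∞` in terms of the norms of `A` and of
its inverse. -/
theorem spectrum_star_mul_self_subset {A B : BoundedOp H} (hAB : A * B = 1) (hBA : B * A = 1)
    {M : ℝ} (hA : ‖A‖ ≤ M) (hB : ‖B‖ ≤ M) :
    spectrum ℝ (star A * A) ⊆ Set.Icc (M ^ 2)⁻¹ (M ^ 2) := by
  intro t ht
  have hnt : Nontrivial (BoundedOp H) := by
    by_contra hnt
    rw [not_nontrivial_iff_subsingleton] at hnt
    exact ht (isUnit_of_subsingleton _)
  have hM : ∀ C : BoundedOp H, ‖C‖ ≤ M → ‖C‖ * ‖C‖ ≤ M ^ 2 := fun C hC => by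
    rw [sq]
    exact mul_self_le_mul_self (norm_nonneg _) hC
  have hstar : star A * star B = 1 := by rw [← star_mul, hBA, star_one]
  have hstar' : star B * star A = 1 := by rw [← star_mul, hAB, star_one]
  let T : (BoundedOp H)ˣ :=
    { val := star A * A
      inv := B * star B
      val_inv := by rw [mul_assoc, ← mul_assoc A, hAB, one_mul, hstar]
      inv_val := by rw [mul_assoc, ← mul_assoc (star B), hstar', one_mul, hBA] }
  have ht0 : 0 ≤ t := spectrum_nonneg_of_nonneg (star_mul_self_nonneg A) ht
  have htne : t ≠ 0 := spectrum.ne_zero_of_mem_of_unit (a := T) ht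
  have hinv : t⁻¹ ∈ spectrum ℝ (B * star B) := by
    have := (spectrum.inv_mem_iff (r := Units.mk0 t htne) (a := T)).1 ht
    simpa [T] using this
  have h1 := spectrum.norm_le_norm_of_mem ht
  have h2 := spectrum.norm_le_norm_of_mem hinv
  rw [CStarRing.norm_star_mul_self, Real.norm_of_nonneg ht0] at h1
  rw [CStarRing.norm_self_mul_star, Real.norm_of_nonneg (inv_nonneg.2 ht0)] at h2
  exact ⟨inv_le_of_inv_le₀ (ht0.lt_of_ne' htne) (h2.trans (hM B hB)), h1.trans (hM A hA)⟩

/-- `log |A|` is the function `log √t` of `A* A`. -/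
theorem opLog_opAbs {A : BoundedOp H} (h : ∀ t ∈ spectrum ℝ (star A * A), t ≠ 0) :
    opLog (opAbs A) = cfc (fun t => Real.log (√t)) (star A * A) := by
  have h0 : 0 ≤ star A * A := star_mul_self_nonneg A
  have hsa : IsSelfAdjoint (star A * A) := .star_mul_self A
  have habs : CFC.abs A = cfc Real.sqrt (star A * A) := by
    rw [CFC.abs, CFC.sqrt_eq_real_sqrt _ h0, cfcₙ_eq_cfc]
  have hlog : ContinuousOn Real.log (Real.sqrt '' spectrum ℝ (star A * A)) := by
    rintro _ ⟨t, ht, rfl⟩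
    refine (Real.continuousAt_log ?_).continuousWithinAt
    exact (Real.sqrt_pos.2 ((spectrum_nonneg_of_nonneg h0 ht).lt_of_ne' (h t ht))).ne'
  rw [opLog, opAbs, CFC.log, habs]
  exact (cfc_comp' Real.log Real.sqrt (star A * A) hlog
    Real.continuous_sqrt.continuousOn hsa).symm

/-- A polynomial that approximates `log √t` uniformly on an interval containing the spectrum of
`A* A` approximates `log |A|` in norm. -/
theorem norm_opLog_opAbs_sub_aeval_le {A : BoundedOp H} {s : Set ℝ}
    (hs : spectrum ℝ (star A * A) ⊆ s) (h0 : ∀ t ∈ s, t ≠ 0) {p : Polynomial ℝ} {ε : ℝ}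
    (hε : 0 ≤ ε) (hp : ∀ t ∈ s, |p.eval t - Real.log (√t)| ≤ ε) :
    ‖opLog (opAbs A) - Polynomial.aeval (star A * A) p‖ ≤ ε := by
  have hsa : IsSelfAdjoint (star A * A) := .star_mul_self A
  have hc : ContinuousOn (fun t => Real.log (√t)) (spectrum ℝ (star A * A)) := by
    refine ContinuousOn.log Real.continuous_sqrt.continuousOn fun t ht => ?_
    have := spectrum_nonneg_of_nonneg (star_mul_self_nonneg A) ht
    exact (Real.sqrt_pos.2 (this.lt_of_ne' (h0 t (hs ht)))).ne'
  rw [opLog_opAbs fun t ht => h0 t (hs ht), ← cfc_polynomial p (star A * A) hsa,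
    ← cfc_sub _ _ _ hc p.continuous.continuousOn]
  refine norm_cfc_le hε fun t ht => ?_
  rw [Real.norm_eq_abs, abs_sub_comm]
  exact hp t (hs ht)

end Log

/-! ### Convergence of the determinants -/

variable {Γ : Type u} [Group Γ]

theorem quotRep_mul_quotRep_eq_one {Γ' : Type u} [Group Γ'] (φ : Γ →* Γ') {f g : L1 Γ}
    (h : conv f g = oneL1 Γ) : quotRep φ f * quotRep φ g = 1 := by
  rw [← quotRep_conv, h, quotRep_oneL1]

/-- For a unit `f` of `L¹(Γ)` the determinant of `φ_* f` is given by the formula for invertible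
operators. -/
theorem fkDet_regRep_pushforward {Γ' : Type u} [Group Γ'] (φ : Γ →* Γ') {f : L1 Γ}
    (hf : IsL1Unit f) : fkDet (regRep (pushforward φ f)) = expTraceLog (quotRep φ f) := by
  obtain ⟨g, hfg, hgf⟩ := hf
  have hu : IsUnit (regRep (pushforward φ f)) := by
    refine ⟨⟨regRep (pushforward φ f), regRep (pushforward φ g), Subtype.ext ?_,
      Subtype.ext ?_⟩, rfl⟩
    · change (regRep (pushforward φ f) : BoundedOp (L2 Γ')) * regRep (pushforward φ g) = 1
      rw [regRep_pushforward, regRep_pushforward, quotRep_mul_quotRep_eq_one φ hfg]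
    · change (regRep (pushforward φ g) : BoundedOp (L2 Γ')) * regRep (pushforward φ f) = 1
      rw [regRep_pushforward, regRep_pushforward, quotRep_mul_quotRep_eq_one φ hgf]
  rw [fkDet, if_pos hu, regRep_pushforward]

theorem regRep_pushforward_id (f : L1 Γ) :
    regRep (pushforward (MonoidHom.id Γ) f) = regRep f :=
  Subtype.ext (regRep_pushforward (MonoidHom.id Γ) f)

/-- The traces `τ(log |A_n|)` converge: up to a uniformly small error they are traces of images of
one and the same element of `L¹(Γ)`. -/
theorem tendsto_vnTrace_opLog {Γ' : ℕ → Type u} [∀ n, Group (Γ' n)] {φ : ∀ n, Γ →* Γ' n}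
    (hφ : ∀ γ, γ ≠ 1 → ∀ᶠ n in atTop, φ n γ ≠ 1) {f : L1 Γ} (hf : IsL1Unit f) :
    Tendsto (fun n => vnTrace (opLog (opAbs (quotRep (φ n) f)))) atTop
      (𝓝 (vnTrace (opLog (opAbs (quotRep (MonoidHom.id Γ) f))))) := by
  obtain ⟨g, hfg, hgf⟩ := hf
  obtain ⟨M, hM0, hMf, hMg⟩ : ∃ M : ℝ, 0 < M ∧ ∑' γ, ‖f γ‖ ≤ M ∧ ∑' γ, ‖g γ‖ ≤ M :=
    ⟨max 1 (max (∑' γ, ‖f γ‖) (∑' γ, ‖g γ‖)), by positivity, by simp, by simp⟩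
  have hpos : ∀ t ∈ Set.Icc (M ^ 2)⁻¹ (M ^ 2), t ≠ 0 := fun t ht =>
    ((by positivity : (0 : ℝ) < (M ^ 2)⁻¹).trans_le ht.1).ne'
  rw [Metric.tendsto_nhds]
  intro ε hε
  obtain ⟨p, hp⟩ := exists_polynomial_near_of_continuousOn (M ^ 2)⁻¹ (M ^ 2)
    (fun t => Real.log (√t)) (ContinuousOn.log Real.continuous_sqrt.continuousOn fun t ht =>
      (Real.sqrt_pos.2 ((by positivity : (0 : ℝ) < (M ^ 2)⁻¹).trans_le ht.1)).ne')
    (ε / 3) (by positivity)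
  obtain ⟨h, hh⟩ := exists_quotRep_eq_aeval f p
  have key : ∀ {Γ'' : Type u} [Group Γ''] (ψ : Γ →* Γ''),
      dist (vnTrace (opLog (opAbs (quotRep ψ f)))) (vnTrace (quotRep ψ h)) ≤ ε / 3 := by
    intro Γ'' _ ψ
    rw [dist_eq_norm, ← vnTrace_sub, hh]
    refine (norm_vnTrace_le _).trans ?_
    exact norm_opLog_opAbs_sub_aeval_le
      (spectrum_star_mul_self_subset (quotRep_mul_quotRep_eq_one ψ hfg)
        (quotRep_mul_quotRep_eq_one ψ hgf) ((norm_quotRep_le ψ f).trans hMf)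
        ((norm_quotRep_le ψ g).trans hMg))
      hpos (by positivity) fun t ht => (hp t ht).le
  filter_upwards [Metric.tendsto_nhds.1 (tendsto_vnTrace_quotRep hφ h) (ε / 3) (by positivity)]
    with n hn
  have h1 := key (φ n)
  have h2 := key (MonoidHom.id Γ)
  rw [dist_comm] at h2
  have h3 := dist_triangle4 (vnTrace (opLog (opAbs (quotRep (φ n) f))))
    (vnTrace (quotRep (φ n) h)) (vnTrace (quotRep (MonoidHom.id Γ) h))
    (vnTrace (opLog (opAbs (quotRep (MonoidHom.id Γ) f))))
  linarith

end GroupDet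

theorem corollary18 {d : ℕ} {Γ : Type u} [Group Γ] (S : Fin d → Γ)
    (hS : Subgroup.closure (Set.range S) = ⊤)
    {Γ' : ℕ → Type u} [∀ n, Group (Γ' n)] (φ : ∀ n, Γ →* Γ' n)
    (hφ : ∀ n, Function.Surjective (φ n))
    (f : GroupDet.L1 Γ) (hf : GroupDet.IsL1Unit f)
    (hconv : Tendsto
      (fun n => GroupDet.MarkedGroupSpace.mk (φ n ∘ S) (GroupDet.closure_range_comp hS (hφ n)))
      atTop (𝓝 (GroupDet.MarkedGroupSpace.mk S hS))) :
    Tendsto (fun n => GroupDet.fkDet (GroupDet.regRep (GroupDet.pushforward (φ n) f)))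
      atTop (𝓝 (GroupDet.fkDet (GroupDet.regRep f))) := by
  rw [← GroupDet.regRep_pushforward_id]
  simp only [GroupDet.fkDet_regRep_pushforward _ hf]
  have h := GroupDet.tendsto_vnTrace_opLog
    (fun γ hγ => GroupDet.eventually_map_ne_one hS hφ hconv hγ) hf
  exact (Real.continuous_exp.comp Complex.continuous_re).continuousAt.tendsto.comp h
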